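/- Let $\mathfrak g$ be a finite-dimensional complex semisimple Lie algebra, $\mathfrak h\subset\mathfrak g$ a Cartan subalgebra, $r=\dim\mathfrak h$ the rank, and $\epsilon\in\mathbb C\setminus\{0\}$. Consider the localization integrand $$F(u)=\frac{N(u)}{D(u)}=\frac{\det'(\mathrm{ad}\,u)}{\det(\mathrm{ad}\,u+\epsilon)},\qquad u\in\mathfrak h,$$ where $\det'(\mathrm{ad}\,u)$ is the determinant of $\mathrm{ad}\,u$ on $\mathfrak g/\mathfrak h$. Let $(e,h,f)$ be a standard triple ($[h,e]=2e$, $[h,f]=-2f$, $[e,f]=h\neq 0$) with $h\in\mathfrak h$, let $\mathfrak g_i$ be the eigenspace of $\mathrm{ad}\,h$ for the eigenvalue $i$, and let $u_0=-\tfrac{\epsilon}{2}h$ be the associated point. Call $e$ (or its orbit) distinguished if the smallest Levi subalgebra of $\mathfrak g$ containing $e$ is $\mathfrak g$; here a Levi subalgebra is the centralizer of a toral subalgebra (a subalgebra consisting of semisimple elements). Then: 1. $[e,u_0]=\epsilon e$ and $D(u_0)=0$. 2. At $u_0$ the numerator $N$ vanishes to order $\dim\mathfrak g_0-\dim\mathfrak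 h$, and the denominator $D$ vanishes to order $\dim\mathfrak g_2$. 3. The order of the pole of $F$ at $u_0$ (its pole order along a line through $u_0$ in general position, negative for a zero) is $\dim\mathfrak g_2-(\dim\mathfrak g_0-\dim\mathfrak h)$. It is at most the rank $r$, with equality if and only if $e$ is distinguished. 4. If some residue of $F$ at $u_0$ is non-zero, then $e$ is distinguished. Here a residue at $u_0$ is an integral $$\frac1{(2\pi i)^r}\oint_{|z_1|=\rho_1}\!\!\cdots\oint_{|z_r|=\rho_r}F\Big(u_0+\sum_j z_jb_j\Big)\,dz_1\cdots dz_r,$$ where $b_1,\dots,b_r$ is any basis of $\mathfrak h$ and $\rho_1,\dots,\rho_r>0$ are any radii such that for every $0<s\le1$ the torus $|z_j|=s\rho_j$ $(1\le j\le r)$ does not meet $\{D=0\}$. In particular this includes all iterated residues in linear coordinates at $u_0$. -/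

import Mathlib

open Module

noncomputable section

namespace MatrixIntegral

section Order

variable {V : Type*} [AddCommGroup V] [Module ℂ V]

/-- The order of vanishing (number of zeros, counted with multiplicity) at `p` of an analytic
function `F` on a finite-dimensional complex vector space: the order of its restriction to a line
through `p`, minimized over all lines.  If `F (p + t • x) = ∑ k, t ^ k * F_k x` is the Taylor
expansion at `p`, this is the least `k` for which the homogeneous polynomial `F_k` is not zero. -/
def vanishingOrder (F : V → ℂ) (p : V) : ℕ∞ :=
  ⨅ x : V, analyticOrderAt (fun t : ℂ => F (p + t • x)) 0

/-- `F` has a pole of order `n : ℤ` at `p`: along every line through `p` in general position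
(direction outside finitely many hyperplanes), the restriction of `F` is meromorphic with a pole
of order exactly `n` at `p`.  A negative `n` means a zero of order `-n`. -/
def HasPoleOrder (F : V → ℂ) (p : V) (n : ℤ) : Prop :=
  ∃ S : Finset (Dual ℂ V), 0 ∉ S ∧ ∀ x : V, (∀ l ∈ S, l x ≠ 0) →
    MeromorphicAt (fun t : ℂ => F (p + t • x)) 0 ∧
      meromorphicOrderAt (fun t : ℂ => F (p + t • x)) 0 = ((-n : ℤ) : WithTop ℤ)

/-- The point with coordinates `z` relative to the origin `p` and the basis `b`. -/
def pointAt {r : ℕ} (b : Basis (Fin r) ℂ V) (p : V) (z : Fin r → ℂ) : V :=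
  p + ∑ j, z j • b j

/-- The torus `|z_j| = ρ_j` in the linear coordinates `z` given by `b`, centred at `p`, is a local
residue cycle at `p` for a function with polar set `{D = 0}`: it can be shrunk to `p` by scaling
without ever meeting the polar set.  Tori with `ρ_{j}` much smaller than `ρ_{j+1}` give the
iterated residues in the coordinates `z`. -/
def IsResidueTorus {r : ℕ} (D : V → ℂ) (p : V) (b : Basis (Fin r) ℂ V) (ρ : Fin r → ℝ) : Prop :=
  (∀ j, 0 < ρ j) ∧
    ∀ s : ℝ, 0 < s → s ≤ 1 → ∀ z : Fin r → ℂ, (∀ j, ‖z j‖ = s * ρ j) → D (pointAt b p z) ≠ 0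

/-- The residue `(2 π i)⁻ʳ ∮ ⋯ ∮ F dz_1 ⋯ dz_r` at `p` over the torus `|z_j| = ρ_j`. -/
def residue {r : ℕ} (F : V → ℂ) (p : V) (b : Basis (Fin r) ℂ V) (ρ : Fin r → ℝ) : ℂ :=
  (2 * (Real.pi : ℂ) * Complex.I)⁻¹ ^ r *
    torusIntegral (fun z : Fin r → ℂ => F (pointAt b p z)) 0 ρ

end Order

section Lie

variable {L : Type*} [LieRing L] [LieAlgebra ℂ L]

/-- An element is semisimple if every `ad x`-invariant subspace has an invariant complement. -/
def IsSemisimpleElement (x : L) : Prop := (LieAlgebra.ad ℂ L x).IsSemisimple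

/-- A toral subalgebra: all of its elements are semisimple. -/
def IsToral (T : LieSubalgebra ℂ L) : Prop := ∀ x ∈ T, IsSemisimpleElement x

/-- Levi subalgebras of a complex semisimple Lie algebra: the centralizers of toral
subalgebras. -/
def IsLevi (l : LieSubalgebra ℂ L) : Prop :=
  ∃ T : LieSubalgebra ℂ L, IsToral T ∧ ∀ y : L, y ∈ l ↔ ∀ x ∈ T, ⁅x, y⁆ = 0

/-- `e` (or its orbit) is distinguished: the smallest Levi subalgebra containing `e` is the whole
Lie algebra. -/
def IsDistinguished (e : L) : Prop :=
  IsLeast {l : LieSubalgebra ℂ L | IsLevi l ∧ e ∈ l} ⊤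

/-- The eigenspace `𝔤_i` of `ad h` for the eigenvalue `i`. -/
def gradedPart (h : L) (i : ℤ) : Submodule ℂ L :=
  Module.End.eigenspace (LieAlgebra.ad ℂ L h) (i : ℂ)

/-- The numerator `det' (ad u)` of the integrand: the determinant of `ad u` on `𝔤 / 𝔥`. -/
def numerator (H : LieSubalgebra ℂ L) (u : H) : ℂ :=
  LinearMap.det (LieModule.toEnd ℂ H (L ⧸ H.toLieSubmodule) u)

/-- The denominator `det (ad u + ε)` of the integrand, the determinant being taken on `𝔤`. -/
def denominator (H : LieSubalgebra ℂ L) (ε : ℂ) (u : H) : ℂ :=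
  LinearMap.det (LieAlgebra.ad ℂ L (u : L) + ε • (LinearMap.id : L →ₗ[ℂ] L))

/-- The localization integrand `det' (ad u) / det (ad u + ε)`, a function on `𝔥`. -/
def integrand (H : LieSubalgebra ℂ L) (ε : ℂ) (u : H) : ℂ :=
  numerator H u / denominator H ε u

/-- The pole given by a standard triple `(e, h, f)` with `h ∈ 𝔥`: the multiple `u = -(ε / 2) h`
of `h`, for which `[e, u] = ε e`. -/
def polePoint (H : LieSubalgebra ℂ L) (ε : ℂ) (h : H) : H := (-(ε / 2)) • h

end Lie

end MatrixIntegral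

end

/-! In a basis of weight vectors, `N` is the product of the nonzero weights and `D` the product of
all `α + ε`. At `u₀` a factor of `N` vanishes iff `α(h) = 0`, and a factor of `D` iff `α(h) = 2`, so
the orders are counts of weights (`card_zeroIndices_numerator`, `card_zeroIndices_denominator`). By
𝔰𝔩₂ theory `ad e ∘ ad f` is injective on `𝔤₂`, so `dim 𝔤₂ ≤ dim 𝔤₀`, which bounds the pole order by
the rank. Equality means that nothing nonzero commutes with both `h` and `e`. By Jordan
decomposition and the Killing form, this says that no nonzero semisimple element commutes with `e`,
that is, `e` is distinguished (`finrank_gradedPart_two_eq_iff_isDistinguished`). For the residue,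
average over simultaneous rotations `z ↦ wz`. This gives circle integrals of `w ^ (r - 1) * F(u₀ + w
v)`, which are holomorphic on the disc if the pole order is below `r`, so Cauchy's theorem applies
(`residue_affineProd_div_eq_zero`). -/

/-! ### Linear algebra of a diagonalized endomorphism. -/

section Eigenbasis

variable {K V ι : Type*} [Field K] [AddCommGroup V] [Module K V]

lemma LinearMap.det_eq_prod_of_basis [Fintype ι] (T : V →ₗ[K] V) (b : Basis ι K V) (c : ι → K)
    (h : ∀ i, T (b i) = c i • b i) : LinearMap.det T = ∏ i, c i := by
  classical
  rw [← LinearMap.det_toMatrix b]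
  have : LinearMap.toMatrix b b T = Matrix.diagonal c := by
    ext i j
    rw [LinearMap.toMatrix_apply, h, map_smul, Finsupp.smul_apply, Basis.repr_self,
      Matrix.diagonal_apply, Finsupp.single_apply]
    by_cases hij : i = j
    · simp [hij]
    · simp [hij, Ne.symm hij]
  rw [this, Matrix.det_diagonal]

open Classical in
lemma Module.Basis.finrank_span_image_filter [Fintype ι] (b : Basis ι K V) (P : ι → Prop) :
    finrank K (Submodule.span K (b '' {i | P i})) = (Finset.univ.filter P).card := by
  rw [Set.image_eq_range]
  refine (finrank_span_eq_card (b.linearIndependent.comp _ Subtype.val_injective)).trans ?_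
  exact Fintype.card_subtype P

/-- The coordinate `b.coord i` is an eigenvector of the transpose of `T` with eigenvalue `c i`, so
it kills eigenvectors with any other eigenvalue. -/
lemma Module.Basis.repr_eq_zero_of_apply_eq_smul (b : Basis ι K V) (T : V →ₗ[K] V) (c : ι → K)
    (h : ∀ i, T (b i) = c i • b i) {x : V} {μ : K} (hx : T x = μ • x) {i : ι} (hi : c i ≠ μ) :
    b.repr x i = 0 := by
  have key : (b.coord i) (T x) = c i * b.coord i x := by
    have : (b.coord i) ∘ₗ T = c i • b.coord i := by
      refine b.ext fun j => ?_
      by_cases hij : j = i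
      · subst hij; simp [h]
      · simp [h, hij]
    exact LinearMap.congr_fun this x
  rw [hx, map_smul, smul_eq_mul, Basis.coord_apply] at key
  by_contra h0
  exact hi (mul_right_cancel₀ h0 key).symm

open Classical in
lemma Module.Basis.finrank_eigenspace_eq_card [Fintype ι] (b : Basis ι K V) (T : V →ₗ[K] V) (c : ι → K)
    (h : ∀ i, T (b i) = c i • b i) (μ : K) :
    finrank K (Module.End.eigenspace T μ) = (Finset.univ.filter fun i => c i = μ).card := by
  rw [← b.finrank_span_image_filter]
  suffices h : Module.End.eigenspace T μ = Submodule.span K (b '' {i | c i = μ}) by rw [h]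
  refine le_antisymm (fun x hx => b.mem_span_image.mpr fun i hi => ?_) (Submodule.span_le.mpr ?_)
  · by_contra hne
    exact (Finsupp.mem_support_iff.mp hi)
      (b.repr_eq_zero_of_apply_eq_smul T c h (Module.End.mem_eigenspace_iff.mp hx) hne)
  · rintro _ ⟨i, rfl, rfl⟩
    exact Module.End.mem_eigenspace_iff.mpr (h i)

end Eigenbasis

/-! ### Weight bases; numerator and denominator as products over weights. -/

namespace MatrixIntegral

variable {L : Type*} [LieRing L] [LieAlgebra ℂ L]

/-- A basis of the Lie algebra consisting of simultaneous eigenvectors of the subalgebra `H`, whose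
members with eigenvalue zero lie in `H`. -/
structure WeightBasis (H : LieSubalgebra ℂ L) (ι : Type*) where
  basis : Basis ι ℂ L
  weight : ι → Dual ℂ H
  lie_basis : ∀ (u : H) (i : ι), ⁅(u : L), basis i⁆ = weight i u • basis i
  mem_of_weight_eq_zero : ∀ i, weight i = 0 → basis i ∈ H

/-- The generalized weight spaces of `H` span `L` directly. Non-degeneracy of the Killing form makes
`H` act on each by scalars, and the zero weight space is `H`. -/
lemma exists_weightBasis [FiniteDimensional ℂ L] [LieAlgebra.IsKilling ℂ L] (H : LieSubalgebra ℂ L)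
    [H.IsCartanSubalgebra] : ∃ (n : ℕ), Nonempty (WeightBasis H (Fin n)) := by
  classical
  have hds := DirectSum.isInternal_submodule_of_iSupIndep_of_iSup_eq_top
    (LieSubmodule.iSupIndep_toSubmodule.mpr <| LieModule.iSupIndep_genWeightSpace' ℂ H L)
    (LieSubmodule.iSup_toSubmodule_eq_top.mpr <| LieModule.iSup_genWeightSpace_eq_top' ℂ H L)
  let v := hds.collectedBasis fun χ => finBasis ℂ (LieModule.genWeightSpace L χ).toSubmodule
  let e := Fintype.equivFin (Σ χ : LieModule.Weight ℂ H L,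
    Fin (finrank ℂ (LieModule.genWeightSpace L χ).toSubmodule))
  have hmem (i) : v i ∈ LieAlgebra.rootSpace H i.1 := hds.collectedBasis_mem _ i
  refine ⟨_, ⟨v.reindex e, fun i => (e.symm i).1.toLinear, fun u i => ?_, fun i hi => ?_⟩⟩
  · rw [Basis.reindex_apply]
    exact LieAlgebra.IsKilling.lie_eq_smul_of_mem_rootSpace (hmem _) u
  · have h0 : (((e.symm i).1 : LieModule.Weight ℂ H L) : H → ℂ) = 0 := by
      ext u
      exact LinearMap.congr_fun hi u
    have := hmem (e.symm i)
    rw [h0, LieAlgebra.rootSpace_zero_eq] at this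
    simpa using this

namespace WeightBasis

variable {H : LieSubalgebra ℂ L} {ι : Type*} [Fintype ι] (B : WeightBasis H ι)

open Classical in
lemma card_weight_eq_zero [IsLieAbelian H] :
    (Finset.univ.filter fun i => B.weight i = 0).card = finrank ℂ H := by
  rw [← B.basis.finrank_span_image_filter]
  suffices h : Submodule.span ℂ (B.basis '' {i | B.weight i = 0}) = H.toSubmodule by
    rw [h]
    rfl
  refine le_antisymm (Submodule.span_le.mpr ?_) fun x hx => B.basis.mem_span_image.mpr fun i hi => ?_
  · rintro _ ⟨i, hi, rfl⟩
    exact B.mem_of_weight_eq_zero i hi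
  · by_contra hne
    obtain ⟨u, hu⟩ : ∃ u, B.weight i u ≠ 0 := by
      by_contra! h
      exact hne (LinearMap.ext h)
    refine (Finsupp.mem_support_iff.mp hi) (B.basis.repr_eq_zero_of_apply_eq_smul
      (LieAlgebra.ad ℂ L (u : L)) (fun j => B.weight j u) (B.lie_basis u) (μ := 0) ?_ hu)
    have : ⁅u, (⟨x, hx⟩ : H)⁆ = 0 := trivial_lie_zero _ _ _ _
    simpa using congrArg Subtype.val this

open Classical in
lemma finrank_gradedPart (h : H) (k : ℤ) :
    finrank ℂ (gradedPart (h : L) k) =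
      (Finset.univ.filter fun i => B.weight i h = k).card :=
  B.basis.finrank_eigenspace_eq_card _ (fun i => B.weight i h) (B.lie_basis h) _

lemma denominator_eq (ε : ℂ) (u : H) : denominator H ε u = ∏ i, (B.weight i u + ε) := by
  refine LinearMap.det_eq_prod_of_basis _ B.basis _ fun i => ?_
  simp [B.lie_basis, add_smul]

open Classical in
-- Basis vectors of weight zero die in the quotient, so the others span it; the dimension count
-- makes their images a basis.
lemma numerator_eq [FiniteDimensional ℂ L] [IsLieAbelian H] (u : H) :
    numerator H u = ∏ i with B.weight i ≠ 0, B.weight i u := by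
  let q : L →ₗ[ℂ] L ⧸ H.toLieSubmodule := (LieSubmodule.Quotient.mk' H.toLieSubmodule).toLinearMap
  have hq : Function.Surjective q := LieSubmodule.Quotient.surjective_mk' _
  let w : {i // B.weight i ≠ 0} → L ⧸ H.toLieSubmodule := fun i => q (B.basis i)
  have hspan : ⊤ ≤ Submodule.span ℂ (Set.range w) := by
    rw [← LinearMap.range_eq_top.mpr hq, LinearMap.range_eq_map, ← B.basis.span_eq,
      Submodule.map_span, Submodule.span_le]
    rintro _ ⟨_, ⟨i, rfl⟩, rfl⟩
    by_cases hi : B.weight i = 0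
    · have : q (B.basis i) = 0 :=
        (LieSubmodule.Quotient.mk_eq_zero (N := H.toLieSubmodule)).mpr (B.mem_of_weight_eq_zero i hi)
      rw [this]
      exact zero_mem _
    · exact Submodule.subset_span ⟨⟨i, hi⟩, rfl⟩
  have hcard : Fintype.card {i // B.weight i ≠ 0} = finrank ℂ (L ⧸ H.toLieSubmodule) := by
    have h1 := Submodule.finrank_quotient_add_finrank H.toLieSubmodule.toSubmodule
    change finrank ℂ (L ⧸ H.toLieSubmodule) + finrank ℂ H = _ at h1
    rw [Fintype.card_subtype_compl, Fintype.card_subtype, B.card_weight_eq_zero,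
      ← finrank_eq_card_basis B.basis, ← h1, Nat.add_sub_cancel]
  let b := basisOfTopLeSpanOfCardEqFinrank w hspan hcard
  rw [numerator, LinearMap.det_eq_prod_of_basis _ b (fun i => B.weight i u) fun i => ?_]
  · exact (Finset.prod_subtype (p := fun i => B.weight i ≠ 0) _ (fun i => by simp)
      fun i => B.weight i u).symm
  · rw [coe_basisOfTopLeSpanOfCardEqFinrank]
    change ⁅u, q (B.basis i)⁆ = _
    have : ⁅u, q (B.basis i)⁆ = q ⁅(u : L), B.basis i⁆ := rfl
    rw [this, B.lie_basis, map_smul]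

end WeightBasis

end MatrixIntegral

/-! ### Zeros and poles of products of affine forms. -/

namespace MatrixIntegral

section AffineProduct

variable {V ι : Type*} [AddCommGroup V] [Module ℂ V]

/-- The product of the affine forms `c i + a i` over `i ∈ s`. -/
noncomputable def affineProd (s : Finset ι) (c : ι → Dual ℂ V) (a : ι → ℂ) (x : V) : ℂ :=
  ∏ i ∈ s, (c i x + a i)

open Classical in
/-- The indices in `s` of the affine forms vanishing at `p`. -/
noncomputable def zeroIndices (s : Finset ι) (c : ι → Dual ℂ V) (a : ι → ℂ) (p : V) : Finset ι :=
  s.filter fun i => c i p + a i = 0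

open Classical in
/-- The product of the affine forms along the line `t ↦ p + t • x`, with the power of `t` coming
from the forms vanishing at `p` removed. -/
noncomputable def reducedProd (s : Finset ι) (c : ι → Dual ℂ V) (a : ι → ℂ) (p x : V) (t : ℂ) : ℂ :=
  (∏ i ∈ zeroIndices s c a p, c i x) *
    ∏ i ∈ s.filter (fun i => ¬ (c i p + a i = 0)), (c i p + a i + t * c i x)

variable {s : Finset ι} {c : ι → Dual ℂ V} {a : ι → ℂ} {p : V}

/-- Each form vanishing at `p` contributes `t * c i x`. All orders of zeros and poles, and the
residue estimate, are read off this factorization. -/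
lemma affineProd_add_smul (x : V) (t : ℂ) :
    affineProd s c a (p + t • x) =
      t ^ (zeroIndices s c a p).card * reducedProd s c a p x t := by
  classical
  rw [affineProd, reducedProd, zeroIndices,
    ← Finset.prod_filter_mul_prod_filter_not s fun i => c i p + a i = 0, ← mul_assoc,
    ← Finset.prod_const, ← Finset.prod_mul_distrib]
  congr 1
  · refine Finset.prod_congr rfl fun i hi => ?_
    rw [map_add, map_smul, smul_eq_mul, add_right_comm, (Finset.mem_filter.mp hi).2, zero_add]
  · refine Finset.prod_congr rfl fun i _ => ?_
    rw [map_add, map_smul, smul_eq_mul, add_right_comm]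

lemma differentiable_reducedProd (x : V) : Differentiable ℂ (reducedProd s c a p x) := by
  unfold reducedProd
  fun_prop

lemma reducedProd_zero_ne_zero {x : V} (hx : ∀ i ∈ zeroIndices s c a p, c i x ≠ 0) :
    reducedProd s c a p x 0 ≠ 0 := by
  classical
  refine mul_ne_zero (Finset.prod_ne_zero_iff.mpr hx) (Finset.prod_ne_zero_iff.mpr fun i hi => ?_)
  simpa using (Finset.mem_filter.mp hi).2

lemma analyticOrderAt_affineProd {x : V} (hx : ∀ i ∈ zeroIndices s c a p, c i x ≠ 0) :
    analyticOrderAt (fun t : ℂ => affineProd s c a (p + t • x)) 0 = (zeroIndices s c a p).card := by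
  have han : AnalyticAt ℂ (reducedProd s c a p x) 0 :=
    (differentiable_reducedProd x).analyticAt 0
  simp_rw [affineProd_add_smul]
  rw [AnalyticAt.analyticOrderAt_eq_natCast (by fun_prop)]
  exact ⟨_, han, reducedProd_zero_ne_zero hx, by simp⟩

lemma card_le_analyticOrderAt_affineProd (x : V) :
    ((zeroIndices s c a p).card : ℕ∞) ≤
      analyticOrderAt (fun t : ℂ => affineProd s c a (p + t • x)) 0 := by
  have han : AnalyticAt ℂ (reducedProd s c a p x) 0 :=
    (differentiable_reducedProd x).analyticAt 0
  simp_rw [affineProd_add_smul]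
  rw [natCast_le_analyticOrderAt (by fun_prop)]
  exact ⟨_, han, by simp⟩

/-- A product of affine forms vanishes at `p` to the order given by the number of forms vanishing
there. -/
lemma vanishingOrder_affineProd (hc : ∀ i ∈ zeroIndices s c a p, c i ≠ 0) :
    vanishingOrder (affineProd s c a) p = (zeroIndices s c a p).card := by
  refine le_antisymm ?_ (le_iInf card_le_analyticOrderAt_affineProd)
  -- The minimum is attained in a direction outside the finitely many kernels of the forms vanishing
  -- at `p`.
  obtain ⟨x, hx⟩ := Module.Dual.exists_forall_ne_zero_of_forall_exists
    (fun i : zeroIndices s c a p => c i) fun i => by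
      by_contra! h
      exact hc i i.2 (LinearMap.ext h)
  exact (iInf_le _ x).trans (analyticOrderAt_affineProd fun i hi => hx ⟨i, hi⟩).le

/-- A quotient of products of affine forms has at `p` the pole order given by the numbers of forms
vanishing there. -/
lemma hasPoleOrder_affineProd_div {s' : Finset ι} {c' : ι → Dual ℂ V} {a' : ι → ℂ}
    (hc : ∀ i ∈ zeroIndices s c a p, c i ≠ 0) (hc' : ∀ i ∈ zeroIndices s' c' a' p, c' i ≠ 0) :
    HasPoleOrder (fun x => affineProd s c a x / affineProd s' c' a' x) p
      ((zeroIndices s' c' a' p).card - (zeroIndices s c a p).card) := by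
  classical
  refine ⟨(zeroIndices s c a p).image c ∪ (zeroIndices s' c' a' p).image c', ?_, fun x hx => ?_⟩
  · simp only [Finset.mem_union, Finset.mem_image, not_or, not_exists, not_and]
    exact ⟨hc, hc'⟩
  have h₁ := analyticOrderAt_affineProd (s := s) (c := c) (a := a) (p := p) (x := x) fun i hi =>
    hx _ (Finset.mem_union_left _ (Finset.mem_image_of_mem c hi))
  have h₂ := analyticOrderAt_affineProd (s := s') (c := c') (a := a') (p := p) (x := x) fun i hi =>
    hx _ (Finset.mem_union_right _ (Finset.mem_image_of_mem c' hi))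
  have han (s : Finset ι) (c : ι → Dual ℂ V) (a : ι → ℂ) :
      AnalyticAt ℂ (fun t : ℂ => affineProd s c a (p + t • x)) 0 := by
    refine Differentiable.analyticAt ?_ 0
    simp_rw [affineProd_add_smul]
    exact (differentiable_id.pow _).mul (differentiable_reducedProd x)
  refine ⟨(han s c a).meromorphicAt.div (han s' c' a').meromorphicAt, ?_⟩
  have h := meromorphicOrderAt_div (han s c a).meromorphicAt (han s' c' a').meromorphicAt
  rw [(han s c a).meromorphicOrderAt_eq, (han s' c' a').meromorphicOrderAt_eq, h₁, h₂] at h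
  refine h.trans ?_
  rw [neg_sub]
  rfl

end AffineProduct

end MatrixIntegral

/-! ### Torus integrals and simultaneous rotation. -/

section Torus

open MeasureTheory Complex

local instance : Fact (0 < 2 * Real.pi) := ⟨Real.two_pi_pos⟩

/-- The point of the torus of polyradius `ρ` with the given angles. -/
noncomputable def anglePoint {r : ℕ} (ρ : Fin r → ℝ) (x : Fin r → AddCircle (2 * Real.pi)) :
    Fin r → ℂ :=
  fun j => ρ j * (AddCircle.toCircle (x j) : ℂ)

lemma continuous_anglePoint {r : ℕ} (ρ : Fin r → ℝ) : Continuous (anglePoint ρ) := by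
  refine continuous_pi fun j => continuous_const.mul ?_
  exact continuous_subtype_val.comp (AddCircle.continuous_toCircle.comp (continuous_apply j))

lemma norm_anglePoint {r : ℕ} {ρ : Fin r → ℝ} (hρ : ∀ j, 0 ≤ ρ j)
    (x : Fin r → AddCircle (2 * Real.pi)) (j : Fin r) : ‖anglePoint ρ x j‖ = ρ j := by
  rw [anglePoint, norm_mul, Circle.norm_coe, mul_one, Complex.norm_real, Real.norm_of_nonneg (hρ j)]

lemma anglePoint_add_const {r : ℕ} (ρ : Fin r → ℝ) (x : Fin r → AddCircle (2 * Real.pi))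
    (φ : AddCircle (2 * Real.pi)) :
    anglePoint ρ (x + fun _ => φ) = (φ.toCircle : ℂ) • anglePoint ρ x := by
  ext j
  simp only [anglePoint, Pi.add_apply, AddCircle.toCircle_add, Circle.coe_mul, Pi.smul_apply,
    smul_eq_mul]
  ring

lemma coe_toCircle_two_pi (θ : ℝ) :
    (AddCircle.toCircle (θ : AddCircle (2 * Real.pi)) : ℂ) = exp (θ * I) := by
  rw [AddCircle.toCircle_apply_mk, Circle.coe_exp]
  congr 2
  rw [div_self Real.two_pi_pos.ne', one_mul]

/-- Angles are moved to a compact group with invariant measure, where rotating all coordinates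
becomes a translation. -/
lemma torusIntegral_eq_integral_addCircle {r : ℕ} (k : (Fin r → ℂ) → ℂ) (ρ : Fin r → ℝ)
    (hk : Continuous fun x => k (anglePoint ρ x)) :
    torusIntegral k 0 ρ =
      ∫ x : Fin r → AddCircle (2 * Real.pi), (∏ j, anglePoint ρ x j * I) * k (anglePoint ρ x) := by
  have hmp : MeasurePreserving
      (fun (θ : Fin r → ℝ) (j : Fin r) => ((θ j : ℝ) : AddCircle (2 * Real.pi)))
      (volume.restrict (Set.univ.pi fun _ => Set.Ioc 0 (0 + 2 * Real.pi))) volume := by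
    rw [volume_pi, volume_pi, Measure.restrict_pi_pi]
    exact measurePreserving_pi _ _ fun _ => AddCircle.measurePreserving_mk _ 0
  have hcont : Continuous fun x : Fin r → AddCircle (2 * Real.pi) =>
      (∏ j, anglePoint ρ x j * I) * k (anglePoint ρ x) := by
    refine Continuous.mul (continuous_finsetProd _ fun j _ => ?_) hk
    exact ((continuous_apply j).comp (continuous_anglePoint ρ)).mul continuous_const
  rw [← hmp.map_eq, integral_map hmp.measurable.aemeasurable hcont.aestronglyMeasurable,
    torusIntegral]
  have hae : (Set.Icc (0 : Fin r → ℝ) fun _ => 2 * Real.pi) =ᵐ[volume]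
      (Set.univ.pi fun _ => Set.Ioc 0 (0 + 2 * Real.pi)) := by
    rw [zero_add, volume_pi]
    exact Measure.univ_pi_Ioc_ae_eq_Icc.symm
  rw [setIntegral_congr_set hae]
  refine integral_congr_ae (Filter.Eventually.of_forall fun θ => ?_)
  have hpt : (anglePoint ρ fun j => ((θ j : ℝ) : AddCircle (2 * Real.pi))) = torusMap 0 ρ θ := by
    ext j
    simp [anglePoint, torusMap, coe_toCircle_two_pi]
  simp only [hpt, smul_eq_mul]
  simp [torusMap]

/-- A torus integral vanishes as soon as the averages of the integrand over the simultaneous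
rotations of all coordinates vanish. -/
lemma torusIntegral_eq_zero_of_circleIntegral_eq_zero {r : ℕ} (hr : r ≠ 0) (k : (Fin r → ℂ) → ℂ)
    (ρ : Fin r → ℝ) (hk : Continuous fun x => k (anglePoint ρ x))
    (h0 : ∀ x : Fin r → AddCircle (2 * Real.pi),
      (∮ w in C(0, 1), w ^ (r - 1) * k (w • anglePoint ρ x)) = 0) :
    torusIntegral k 0 ρ = 0 := by
  rw [torusIntegral_eq_integral_addCircle k ρ hk]
  set G : (Fin r → AddCircle (2 * Real.pi)) → ℂ :=
    fun x => (∏ j, anglePoint ρ x j * I) * k (anglePoint ρ x) with hG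
  have hcont : Continuous G := by
    refine Continuous.mul (continuous_finsetProd _ fun j _ => ?_) hk
    exact ((continuous_apply j).comp (continuous_anglePoint ρ)).mul continuous_const
  have hinner (x : Fin r → AddCircle (2 * Real.pi)) :
      ∫ φ : AddCircle (2 * Real.pi), G (x + fun _ => φ) = 0 := by
    rw [← AddCircle.intervalIntegral_preimage (2 * Real.pi) 0, zero_add]
    have h := h0 x
    rw [circleIntegral] at h
    -- Rotation multiplies the Jacobian by `w ^ r`; one factor `w` is absorbed by `dw`, which leaves
    -- the exponent `r - 1`.
    have hθ (θ : ℝ) : G (x + fun _ => (θ : AddCircle (2 * Real.pi))) =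
        (∏ j, anglePoint ρ x j * I) * I⁻¹ * (deriv (circleMap 0 1) θ •
          (circleMap 0 1 θ ^ (r - 1) * k (circleMap 0 1 θ • anglePoint ρ x))) := by
      have hw : ((AddCircle.toCircle (θ : AddCircle (2 * Real.pi)) : Circle) : ℂ) =
          circleMap 0 1 θ := by
        simp [coe_toCircle_two_pi, circleMap]
      simp only [hG, anglePoint_add_const, hw, deriv_circleMap, smul_eq_mul, Pi.smul_apply]
      have hp : ∏ j, circleMap 0 1 θ * anglePoint ρ x j * I =
          circleMap 0 1 θ ^ r * ∏ j, anglePoint ρ x j * I := by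
        simp_rw [mul_assoc]
        rw [Finset.prod_mul_distrib]
        simp
      have hr' : circleMap 0 1 θ ^ r = circleMap 0 1 θ * circleMap 0 1 θ ^ (r - 1) := by
        rw [← pow_succ', Nat.sub_add_cancel (Nat.one_le_iff_ne_zero.mpr hr)]
      rw [hp, hr']
      linear_combination (- (circleMap 0 1 θ * circleMap 0 1 θ ^ (r - 1) *
        (∏ j, anglePoint ρ x j * I) * k (circleMap 0 1 θ • anglePoint ρ x))) *
          inv_mul_cancel₀ I_ne_zero
    simp_rw [hθ]
    rw [intervalIntegral.integral_const_mul, h, mul_zero]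
  have hshift (φ : AddCircle (2 * Real.pi)) : ∫ x, G (x + fun _ => φ) = ∫ x, G x :=
    integral_add_right_eq_self G _
  have hint : Integrable (fun q : AddCircle (2 * Real.pi) × (Fin r → AddCircle (2 * Real.pi)) =>
      G (q.2 + fun _ => q.1)) (volume.prod volume) := by
    refine Continuous.integrable_of_hasCompactSupport (by fun_prop) ?_
    exact HasCompactSupport.of_compactSpace _
  -- By invariance one iterated integral is the circle's length times the integral of `G`; the other
  -- order gives zero.
  have hswap := integral_integral_swap
    (f := fun (φ : AddCircle (2 * Real.pi)) (x : Fin r → AddCircle (2 * Real.pi)) =>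
      G (x + fun _ => φ)) hint
  simp_rw [hshift, hinner] at hswap
  simpa [Real.pi_ne_zero, Measure.real, Real.pi_nonneg] using hswap

end Torus

/-! ### Vanishing of residues when the pole order is below the dimension. -/

namespace MatrixIntegral

variable {V ι : Type*} [AddCommGroup V] [Module ℂ V] {s s' : Finset ι} {c c' : ι → Dual ℂ V}
  {a a' : ι → ℂ} {p : V}

lemma reducedProd_ne_zero {x : V}
    (hx : ∀ w : ℂ, 0 < ‖w‖ → ‖w‖ ≤ 1 → affineProd s c a (p + w • x) ≠ 0) {w : ℂ} (hw : ‖w‖ ≤ 1) :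
    reducedProd s c a p x w ≠ 0 := by
  rcases eq_or_ne w 0 with rfl | h0
  · have h1 := hx 1 (by simp) (by simp)
    rw [affineProd_add_smul] at h1
    refine reducedProd_zero_ne_zero ?_
    exact Finset.prod_ne_zero_iff.mp (left_ne_zero_of_mul (right_ne_zero_of_mul h1))
  · have h1 := hx w (norm_pos_iff.mpr h0) hw
    rw [affineProd_add_smul] at h1
    exact right_ne_zero_of_mul h1

lemma pointAt_smul {r : ℕ} (b : Basis (Fin r) ℂ V) (p : V) (w : ℂ) (z : Fin r → ℂ) :
    pointAt b p (w • z) = p + w • ∑ j, z j • b j := by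
  simp [pointAt, Finset.smul_sum, smul_smul]

/-- The residues of a quotient of products of affine forms vanish at a point where the pole order is
less than the dimension. -/
lemma residue_affineProd_div_eq_zero {r : ℕ} (b : Basis (Fin r) ℂ V) {ρ : Fin r → ℝ}
    (hρ : IsResidueTorus (affineProd s' c' a') p b ρ)
    (hlt : (zeroIndices s' c' a' p).card < (zeroIndices s c a p).card + r) :
    residue (fun x => affineProd s c a x / affineProd s' c' a' x) p b ρ = 0 := by
  obtain ⟨hpos, hne⟩ := hρ
  rw [residue]
  -- In dimension zero the torus integral is evaluation at `p`, where `hlt` forces the numerator to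
  -- vanish.
  rcases Nat.eq_zero_or_pos r with rfl | hr
  · obtain ⟨i, hi⟩ := Finset.card_pos.mp (Nat.zero_lt_of_lt hlt)
    have h0 : affineProd s c a p = 0 :=
      Finset.prod_eq_zero (Finset.mem_filter.mp hi).1 (Finset.mem_filter.mp hi).2
    simp [torusIntegral_dim0, pointAt, h0]
  rw [torusIntegral_eq_zero_of_circleIntegral_eq_zero hr.ne' _ ρ ?_ fun x => ?_, mul_zero]
  · have hc (s : Finset ι) (c : ι → Dual ℂ V) (a : ι → ℂ) :
        Continuous fun x => affineProd s c a (pointAt b p (anglePoint ρ x)) := by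
      have := continuous_anglePoint ρ
      simp only [affineProd, pointAt, map_add, map_sum, map_smul, smul_eq_mul]
      fun_prop
    refine (hc s c a).div (hc s' c' a') fun x => ?_
    exact hne 1 one_pos le_rfl _ fun j => by rw [norm_anglePoint fun j => (hpos j).le, one_mul]
  · set v := ∑ j, anglePoint ρ x j • b j
    have hD (w : ℂ) (h0 : 0 < ‖w‖) (h1 : ‖w‖ ≤ 1) : affineProd s' c' a' (p + w • v) ≠ 0 := by
      rw [← pointAt_smul]
      refine hne ‖w‖ h0 h1 _ fun j => ?_
      rw [Pi.smul_apply, norm_smul, norm_anglePoint fun j => (hpos j).le]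
    -- By `hlt`, the factor `w ^ (r - 1)` and the zeros of the numerator absorb the whole pole at `w
    -- = 0`, leaving `w ^ m` with `m ≥ 0`.
    obtain ⟨m, hm⟩ : ∃ m, (zeroIndices s c a p).card + (r - 1) = (zeroIndices s' c' a' p).card + m :=
      ⟨_, (Nat.add_sub_cancel' (by omega)).symm⟩
    have heq : Set.EqOn (fun w : ℂ => w ^ (r - 1) * (affineProd s c a (pointAt b p
          (w • anglePoint ρ x)) / affineProd s' c' a' (pointAt b p (w • anglePoint ρ x))))
        (fun w => w ^ m * (reducedProd s c a p v w / reducedProd s' c' a' p v w))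
        (Metric.sphere 0 1) := by
      intro w hw
      have hw1 : ‖w‖ = 1 := by simpa using hw
      have hw0 : w ≠ 0 := norm_pos_iff.mp (by rw [hw1]; exact one_pos)
      have hred := reducedProd_ne_zero hD hw1.le
      simp only [pointAt_smul, affineProd_add_smul]
      rw [← mul_div_assoc, ← mul_div_assoc, div_eq_div_iff (mul_ne_zero (pow_ne_zero _ hw0) hred)
        hred, ← mul_assoc, ← pow_add, add_comm (r - 1), hm, pow_add]
      ring
    rw [circleIntegral.integral_congr zero_le_one heq]
    refine Complex.circleIntegral_eq_zero_of_differentiable_on_off_countable zero_le_one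
      Set.countable_empty ?_ ?_
    · refine (continuous_id.pow m).continuousOn.mul
        ((differentiable_reducedProd v).continuous.continuousOn.div
          (differentiable_reducedProd v).continuous.continuousOn fun w hw => ?_)
      exact reducedProd_ne_zero hD (by simpa using hw)
    · intro w hw
      refine (differentiableAt_id.pow m).mul ((differentiable_reducedProd v w).div
        (differentiable_reducedProd v w) (reducedProd_ne_zero hD ?_))
      exact (show ‖w‖ < 1 by simpa using hw.1).le

end MatrixIntegral

/-! ### 𝔰𝔩₂-triples acting on degrees `0` and `2`. -/

namespace MatrixIntegral

variable {L : Type*} [LieRing L] [LieAlgebra ℂ L]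

lemma mem_gradedPart {h x : L} {i : ℤ} : x ∈ gradedPart h i ↔ ⁅h, x⁆ = (i : ℂ) • x := by
  rw [gradedPart, Module.End.mem_eigenspace_iff, LieAlgebra.ad_apply]

section Sl2

variable {h e f : L} (t : IsSl2Triple h e f)
include t

lemma lie_e_mem_gradedPart {i : ℤ} {x : L} (hx : x ∈ gradedPart h i) :
    ⁅e, x⁆ ∈ gradedPart h (i + 2) := by
  rw [mem_gradedPart] at *
  rw [leibniz_lie, t.lie_h_e_smul ℂ, hx, smul_lie, lie_smul, ← add_smul]
  push_cast
  rw [add_comm]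

lemma lie_f_mem_gradedPart {i : ℤ} {x : L} (hx : x ∈ gradedPart h i) :
    ⁅f, x⁆ ∈ gradedPart h (i - 2) := by
  rw [mem_gradedPart] at *
  rw [leibniz_lie, t.lie_lie_smul_f ℂ, hx, neg_lie, smul_lie, lie_smul, ← neg_smul, ← add_smul]
  push_cast
  rw [sub_eq_neg_add]

variable [FiniteDimensional ℂ L]

/-- The composition of `ad f : 𝔤₂ → 𝔤₀` and `ad e : 𝔤₀ → 𝔤₂` is injective. -/
lemma eq_zero_of_lie_e_lie_f_eq_zero {v : L} (hv : v ∈ gradedPart h 2)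
    (h0 : ⁅e, ⁅f, v⁆⁆ = 0) : v = 0 := by
  set E := LieAlgebra.ad ℂ L e with hE
  have hsucc (k : ℕ) : (E ^ (k + 1)) v = ⁅e, (E ^ k) v⁆ := by
    rw [pow_succ', Module.End.mul_apply, hE, LieAlgebra.ad_apply]
  have hgr (k : ℕ) : (E ^ k) v ∈ gradedPart h (2 + 2 * k) := by
    induction k with
    | zero => simpa using hv
    | succ k ih =>
      rw [hsucc]
      convert! lie_e_mem_gradedPart t ih using 2
  have hef (w : L) : ⁅f, ⁅e, w⁆⁆ = ⁅e, ⁅f, w⁆⁆ - ⁅h, w⁆ := by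
    rw [← t.lie_e_f, lie_lie, sub_sub_cancel]
  -- The coefficient collects the `h`-weights: `2 + 4 + ⋯ + 2(k + 1) = (k + 1)(k + 2)`. It never
  -- vanishes, so `E ^ (k + 1)` killing `v` implies that `E ^ k` does.
  have hf (k : ℕ) : ⁅f, (E ^ (k + 1)) v⁆ = (-((k + 1) * (k + 2)) : ℂ) • (E ^ k) v := by
    induction k with
    | zero =>
      rw [hsucc, hef, pow_zero, Module.End.one_apply, h0, mem_gradedPart.mp hv, zero_sub, ← neg_smul]
      norm_num
    | succ k ih =>
      rw [hsucc, hef, ih, lie_smul, ← hsucc, mem_gradedPart.mp (hgr _), ← sub_smul]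
      push_cast
      ring_nf
  -- Otherwise `ad h` would have infinitely many eigenvalues `2 + 2k`.
  have hex : ∃ k, (E ^ k) v = 0 := by
    by_contra! hne
    have hinj : Function.Injective fun k : ℕ => (((2 + 2 * k : ℕ) : ℤ) : ℂ) := by
      intro a b hab
      have : 2 + 2 * a = 2 + 2 * b := Nat.cast_injective (R := ℤ) (Int.cast_injective hab)
      omega
    refine Set.infinite_of_injective_forall_mem hinj (fun k => ?_)
      (Module.End.finite_hasEigenvalue (LieAlgebra.ad ℂ L h))
    refine Module.End.hasEigenvalue_of_hasEigenvector (x := (E ^ k) v) ⟨?_, hne k⟩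
    simpa [gradedPart] using hgr k
  obtain ⟨k, hk⟩ := hex
  induction k with
  | zero => simpa using hk
  | succ k ih =>
    refine ih ?_
    have := hf k
    rw [hk, lie_zero, eq_comm, smul_eq_zero, neg_eq_zero, mul_eq_zero] at this
    refine this.resolve_left ?_
    norm_cast

/-- The map `ad e : 𝔤₀ → 𝔤₂`. -/
noncomputable def raising : gradedPart h 0 →ₗ[ℂ] gradedPart h 2 :=
  (LieAlgebra.ad ℂ L e).restrict fun x (hx : x ∈ gradedPart h 0) => by
    simpa using lie_e_mem_gradedPart t hx

/-- The map `ad f : 𝔤₂ → 𝔤₀`. -/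
noncomputable def lowering : gradedPart h 2 →ₗ[ℂ] gradedPart h 0 :=
  (LieAlgebra.ad ℂ L f).restrict fun x (hx : x ∈ gradedPart h 2) => by
    simpa using lie_f_mem_gradedPart t hx

lemma injective_raising_comp_lowering : Function.Injective (raising t ∘ₗ lowering t) := by
  rw [injective_iff_map_eq_zero]
  intro v hv
  exact Subtype.ext (eq_zero_of_lie_e_lie_f_eq_zero t v.2 (congrArg Subtype.val hv))

lemma surjective_raising_comp_lowering : Function.Surjective (raising t ∘ₗ lowering t) :=
  LinearMap.injective_iff_surjective.mp (injective_raising_comp_lowering t)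

lemma surjective_raising : Function.Surjective (raising t) :=
  Function.Surjective.of_comp (g := lowering t) (surjective_raising_comp_lowering t)

lemma finrank_gradedPart_two_le : finrank ℂ (gradedPart h 2) ≤ finrank ℂ (gradedPart h 0) :=
  LinearMap.finrank_le_finrank_of_injective (f := lowering t)
    (Function.Injective.of_comp (f := raising t) (injective_raising_comp_lowering t))

/-- As `ad e : 𝔤₀ → 𝔤₂` is surjective, the dimensions agree exactly when its kernel is zero. -/
lemma finrank_gradedPart_two_eq_iff :
    finrank ℂ (gradedPart h 2) = finrank ℂ (gradedPart h 0) ↔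
      ∀ x : L, ⁅h, x⁆ = 0 → ⁅e, x⁆ = 0 → x = 0 := by
  have hker : (∀ x : L, ⁅h, x⁆ = 0 → ⁅e, x⁆ = 0 → x = 0) ↔ Function.Injective (raising t) := by
    rw [injective_iff_map_eq_zero]
    refine ⟨fun H x hx => Subtype.ext (H x ?_ (congrArg Subtype.val hx)), fun H x hx hex => ?_⟩
    · simpa using mem_gradedPart.mp x.2
    · have hx0 : x ∈ gradedPart h 0 := by simpa [mem_gradedPart] using hx
      exact congrArg Subtype.val (H ⟨x, hx0⟩ (Subtype.ext hex))
  rw [hker]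
  refine ⟨fun heq => (LinearMap.injective_iff_surjective_of_finrank_eq_finrank heq.symm).mpr
    (surjective_raising t), fun hinj => ?_⟩
  exact (LinearEquiv.ofBijective _ ⟨hinj, surjective_raising t⟩).finrank_eq.symm

/-- Since `ad e ∘ ad f` is onto `𝔤₂`, `𝔤₀` is the sum of the kernel of `ad e` on it and `[f, 𝔤₂]`.
-/
lemma exists_lie_e_sub_lie_f_eq_zero {x : L} (hx : ⁅h, x⁆ = 0) :
    ∃ v, ⁅h, x - ⁅f, v⁆⁆ = 0 ∧ ⁅e, x - ⁅f, v⁆⁆ = 0 := by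
  have hx0 : x ∈ gradedPart h 0 := by simpa [mem_gradedPart] using hx
  obtain ⟨v, hv⟩ := surjective_raising_comp_lowering t (raising t ⟨x, hx0⟩)
  refine ⟨v, ?_, ?_⟩
  · have := mem_gradedPart.mp (sub_mem hx0 (lowering t v).2)
    rwa [Int.cast_zero, zero_smul] at this
  · have : ⁅e, ⁅f, (v : L)⁆⁆ = ⁅e, x⁆ := congrArg Subtype.val hv
    rw [lie_sub, this, sub_self]

/-- A highest weight vector of weight `0` generates the trivial representation. -/
lemma lie_f_eq_zero {x : L} (hx : ⁅h, x⁆ = 0) (hex : ⁅e, x⁆ = 0) : ⁅f, x⁆ = 0 := by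
  rcases eq_or_ne x 0 with rfl | h0
  · exact lie_zero f
  have P : t.HasPrimitiveVectorWith x (0 : ℂ) := ⟨h0, by rw [hx, zero_smul], hex⟩
  simpa using P.pow_toEnd_f_eq_zero_of_eq_nat (n := 0) (by simp)

end Sl2

end MatrixIntegral

/-! ### Distinguished elements and semisimple elements commuting with `e`. -/

namespace MatrixIntegral

variable {L : Type*} [LieRing L] [LieAlgebra ℂ L]

lemma lie_mem_eigenspace_ad {h x y : L} {μ ν : ℂ}
    (hx : x ∈ Module.End.eigenspace (LieAlgebra.ad ℂ L h) μ)
    (hy : y ∈ Module.End.eigenspace (LieAlgebra.ad ℂ L h) ν) :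
    ⁅x, y⁆ ∈ Module.End.eigenspace (LieAlgebra.ad ℂ L h) (μ + ν) := by
  rw [Module.End.mem_eigenspace_iff, LieAlgebra.ad_apply] at *
  rw [leibniz_lie, hx, hy, smul_lie, lie_smul, ← add_smul]

variable [FiniteDimensional ℂ L]

lemma eq_zero_of_forall_lie_eq_zero [LieAlgebra.IsKilling ℂ L] {x : L} (h : ∀ y : L, ⁅x, y⁆ = 0) :
    x = 0 :=
  (LieDerivation.IsKilling.ad_apply_eq_zero_iff ℂ L x).mp (LieDerivation.ext fun y => by simp [h])

/-- An element whose components with respect to `ad h` have eigenvalues with real part at least one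
is nilpotent. -/
lemma isNilpotent_ad_of_mem_iSup_eigenspace {h x : L} (hss : IsSemisimpleElement h)
    (hx : x ∈ ⨆ (μ : ℂ) (_ : 1 ≤ μ.re), Module.End.eigenspace (LieAlgebra.ad ℂ L h) μ) :
    IsNilpotent (LieAlgebra.ad ℂ L x) := by
  set A := LieAlgebra.ad ℂ L h
  -- In this filtration by real parts, `ad x` raises the index by one. With `M` exceeding all real
  -- parts in absolute value, `2M` steps lead from `U (-M) = ⊤` to `U M = ⊥`.
  let U : ℝ → Submodule ℂ L := fun m => ⨆ (μ : ℂ) (_ : m ≤ μ.re), A.eigenspace μ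
  have hU {m : ℝ} {μ : ℂ} (hμ : m ≤ μ.re) : A.eigenspace μ ≤ U m :=
    le_iSup₂_of_le μ hμ le_rfl
  have hstep {m : ℝ} {y : L} (hy : y ∈ U m) : ⁅x, y⁆ ∈ U (m + 1) := by
    rw [← lie_skew, neg_mem_iff]
    suffices H : U 1 ≤ (U (m + 1)).comap (LieAlgebra.ad ℂ L y) from H hx
    refine iSup₂_le fun μ hμ a ha => ?_
    change ⁅y, a⁆ ∈ U (m + 1)
    rw [← lie_skew, neg_mem_iff]
    suffices H : U m ≤ (U (m + 1)).comap (LieAlgebra.ad ℂ L a) from H hy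
    refine iSup₂_le fun ν hν b hb => ?_
    refine hU (μ := μ + ν) ?_ (lie_mem_eigenspace_ad ha hb)
    rw [Complex.add_re]
    linarith
  obtain ⟨M, hM⟩ : ∃ M : ℕ, ∀ μ, A.HasEigenvalue μ → |μ.re| < M := by
    obtain ⟨C, hC⟩ := ((Module.End.finite_hasEigenvalue A).image fun μ => |μ.re|).bddAbove
    obtain ⟨M, hM⟩ := exists_nat_gt C
    exact ⟨M, fun μ hμ => (hC ⟨μ, hμ, rfl⟩).trans_lt hM⟩
  have htop : U (-M) = ⊤ := by
    rw [eq_top_iff, ← hss.iSup_eigenspace_eq_top]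
    refine iSup_le fun μ => ?_
    by_cases hμ : A.HasEigenvalue μ
    · exact hU (abs_lt.mp (hM μ hμ)).1.le
    · exact (not_ne_iff.mp hμ).le.trans bot_le
  have hbot : U M = ⊥ := by
    refine (iSup₂_eq_bot).mpr fun μ hμ => ?_
    by_contra hne
    exact absurd (hM μ hne) (not_lt.mpr (hμ.trans (le_abs_self _)))
  have hpow (k : ℕ) (y : L) : ((LieAlgebra.ad ℂ L x) ^ k) y ∈ U (-M + k) := by
    induction k with
    | zero => simp [htop]
    | succ k ih =>
      rw [pow_succ', Module.End.mul_apply, LieAlgebra.ad_apply]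
      push_cast
      rw [← add_assoc]
      exact hstep ih
  refine ⟨M + M, LinearMap.ext fun y => ?_⟩
  have := hpow (M + M) y
  push_cast at this
  rwa [neg_add_cancel_left, hbot, Submodule.mem_bot] at this

/-- If no non-zero element commutes with both `h` and `e`, then no non-zero semisimple element
commutes with `e`. -/
lemma eq_zero_of_isSemisimpleElement_of_lie_eq_zero [LieAlgebra.IsKilling ℂ L] {h e f : L}
    (t : IsSl2Triple h e f) (hss : IsSemisimpleElement h)
    (hc : ∀ x : L, ⁅h, x⁆ = 0 → ⁅e, x⁆ = 0 → x = 0) {x : L} (hx : IsSemisimpleElement x)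
    (hxe : ⁅x, e⁆ = 0) : x = 0 := by
  set Z := LinearMap.ker (LieAlgebra.ad ℂ L e)
  have hZ : ∀ z ∈ Z, LieAlgebra.ad ℂ L h z ∈ Z := by
    intro z hz
    have hz' : ⁅e, z⁆ = 0 := hz
    change ⁅e, ⁅h, z⁆⁆ = 0
    rw [leibniz_lie, ← lie_skew e h, t.lie_h_e_smul ℂ, hz', lie_zero, neg_lie, smul_lie, hz', smul_zero,
      neg_zero, add_zero]
  have hmem : x ∈ Z ⊓ ⨆ μ, (LieAlgebra.ad ℂ L h).genEigenspace μ 1 := by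
    refine ⟨?_, ?_⟩
    · change ⁅e, x⁆ = 0
      rw [← lie_skew, hxe, neg_zero]
    · have := hss.iSup_eigenspace_eq_top
      simp only [Module.End.eigenspace] at this
      rw [this]
      trivial
  -- The centralizer `Z` of `e` is `ad h`-stable, so `x` splits into `h`-eigenvectors inside it.
  -- These are highest weight vectors, with natural number weights, and `hc` excludes weight `0`;
  -- hence `ad x` is nilpotent as well as semisimple.
  rw [Submodule.inf_iSup_genEigenspace hZ] at hmem
  have hnil : IsNilpotent (LieAlgebra.ad ℂ L x) := by
    refine isNilpotent_ad_of_mem_iSup_eigenspace hss ?_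
    refine (iSup_le fun μ => ?_ : (⨆ μ, Z ⊓ (LieAlgebra.ad ℂ L h).genEigenspace μ 1) ≤ _) hmem
    rintro z ⟨hz, hzμ⟩
    rcases eq_or_ne z 0 with rfl | h0
    · exact zero_mem _
    have hzh : ⁅h, z⁆ = μ • z := Module.End.mem_eigenspace_iff.mp hzμ
    have P : t.HasPrimitiveVectorWith z μ := ⟨h0, hzh, hz⟩
    obtain ⟨n, rfl⟩ := P.exists_nat
    refine Submodule.mem_iSup_of_mem (n : ℂ) (Submodule.mem_iSup_of_mem ?_ hzμ)
    rw [Complex.natCast_re, Nat.one_le_cast, Nat.one_le_iff_ne_zero]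
    rintro rfl
    exact h0 (hc z (by simpa using hzh) hz)
  exact eq_zero_of_forall_lie_eq_zero
    (LinearMap.congr_fun (Module.End.eq_zero_of_isNilpotent_isSemisimple hnil hx))

/-- The semisimple part of an element of a Lie algebra with non-degenerate Killing form. -/
lemma exists_semisimple_part [LieAlgebra.IsKilling ℂ L] (x : L) :
    ∃ y : L, IsSemisimpleElement y ∧
      IsNilpotent (LieAlgebra.ad ℂ L x - LieAlgebra.ad ℂ L y) ∧ ∀ z : L, ⁅x, z⁆ = 0 → ⁅y, z⁆ = 0 := by
  obtain ⟨N, -, S, hS₀, hN, hS, hSN⟩ := (LieAlgebra.ad ℂ L x).exists_isNilpotent_isSemisimple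
  replace hS₀ : Commute (LieAlgebra.ad ℂ L x) S := Algebra.commute_of_mem_adjoin_self hS₀
  rw [eq_sub_of_add_eq hSN.symm] at hN
  have aux {μ : ℂ} {y : L} (hy : y ∈ (LieAlgebra.ad ℂ L x).maxGenEigenspace μ) : S y = μ • y :=
    Module.End.apply_eq_of_mem_of_comm_of_isFinitelySemisimple_of_isNil hy hS₀
      hS.isFinitelySemisimple hN
  -- `S` is scalar on generalized eigenspaces of `ad x`, and brackets add their eigenvalues. So `S`
  -- is a derivation, hence inner.
  have h_der (y z : L) : S ⁅y, z⁆ = ⁅S y, z⁆ + ⁅y, S z⁆ := by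
    have hy : y ∈ ⨆ μ, (LieAlgebra.ad ℂ L x).maxGenEigenspace μ := by
      simp [Module.End.iSup_maxGenEigenspace_eq_top]
    have hz : z ∈ ⨆ μ, (LieAlgebra.ad ℂ L x).maxGenEigenspace μ := by
      simp [Module.End.iSup_maxGenEigenspace_eq_top]
    induction hy using Submodule.iSup_induction' with
    | mem μ y hy =>
      induction hz using Submodule.iSup_induction' with
      | mem ν z hz =>
        rw [aux hy, aux hz, aux (LieModule.lie_mem_maxGenEigenspace_toEnd hy hz), smul_lie, lie_smul,
          ← add_smul]
      | zero => simp
      | add _ _ _ _ h h' => simp only [lie_add, map_add, h, h']; abel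
    | zero => simp
    | add _ _ _ _ h h' => simp only [add_lie, map_add, h, h']; abel
  obtain ⟨y, hy⟩ := LieDerivation.IsKilling.exists_eq_ad (R := ℂ) (L := L)
    ⟨S, fun a b => by rw [h_der, ← lie_skew (S a) b, neg_add_eq_sub]⟩
  have hyS : LieAlgebra.ad ℂ L y = S := by
    rw [← LieDerivation.coe_ad_apply_eq_ad_apply y, hy]
  refine ⟨y, by rwa [IsSemisimpleElement, hyS], by rwa [hyS], fun z hz => ?_⟩
  rw [← LieAlgebra.ad_apply ℂ, hyS, aux (μ := 0) (y := z), zero_smul]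
  refine (Module.End.genEigenspace _ _).mono le_top ?_ (a := (1 : ℕ∞))
  exact Module.End.mem_eigenspace_iff.mpr (by simpa using hz)

/-- A non-zero element commuting with an `𝔰𝔩₂`-triple produces a non-zero semisimple element doing
so. -/
lemma exists_isSemisimpleElement_lie_eq_zero [LieAlgebra.IsKilling ℂ L] {h e f : L}
    (t : IsSl2Triple h e f) (hss : IsSemisimpleElement h) {y : L} (hy0 : y ≠ 0)
    (hhy : ⁅h, y⁆ = 0) (hey : ⁅e, y⁆ = 0) : ∃ x : L, IsSemisimpleElement x ∧ ⁅x, e⁆ = 0 ∧ x ≠ 0 := by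
  -- If the Killing form were isotropic on the common centralizer of `h` and `e`, polarization would
  -- make `y` orthogonal to it. Invariance makes `y` orthogonal to the nonzero `h`-eigenspaces and
  -- to `[f, 𝔤₂]`, hence to all of `L`.
  obtain ⟨x, hhx, hex, hxx⟩ :
      ∃ x : L, ⁅h, x⁆ = 0 ∧ ⁅e, x⁆ = 0 ∧ killingForm ℂ L x x ≠ 0 := by
    by_contra! H
    have hpol (z : L) (hhz : ⁅h, z⁆ = 0) (hez : ⁅e, z⁆ = 0) : killingForm ℂ L y z = 0 := by
      have h1 := H (y + z) (by rw [lie_add, hhy, hhz, add_zero]) (by rw [lie_add, hey, hez, add_zero])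
      have h2 := LieModule.traceForm_comm ℂ L L z y
      simp only [map_add, LinearMap.add_apply, H y hhy hey, H z hhz hez, zero_add, add_zero, h2]
        at h1
      simpa using h1
    have hker : killingForm ℂ L y = 0 := by
      rw [← LinearMap.ker_eq_top, eq_top_iff, ← hss.iSup_eigenspace_eq_top]
      refine iSup_le fun μ z hz => ?_
      have hhz : ⁅h, z⁆ = μ • z := Module.End.mem_eigenspace_iff.mp hz
      rw [LinearMap.mem_ker]
      rcases eq_or_ne μ 0 with rfl | hμ
      · rw [zero_smul] at hhz
        obtain ⟨v, hv1, hv2⟩ := exists_lie_e_sub_lie_f_eq_zero t hhz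
        have h1 := hpol _ hv1 hv2
        have h2 : killingForm ℂ L y ⁅f, v⁆ = 0 := by
          rw [← LieModule.traceForm_apply_lie_apply, ← lie_skew, lie_f_eq_zero t hhy hey, neg_zero,
            map_zero, LinearMap.zero_apply]
        rwa [map_sub, h2, sub_zero] at h1
      · have h1 := LieModule.traceForm_apply_lie_apply ℂ L L y h z
        rw [← lie_skew, hhy, neg_zero, map_zero, LinearMap.zero_apply, hhz, map_smul, eq_comm,
          smul_eq_zero] at h1
        exact h1.resolve_left hμ
    refine hy0 ?_
    have : y ∈ LinearMap.ker (killingForm ℂ L) := hker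
    rwa [LieAlgebra.IsKilling.ker_killingForm_eq_bot, Submodule.mem_bot] at this
  -- Were the semisimple part zero, `ad x` would be nilpotent and the trace of its square would
  -- vanish.
  obtain ⟨s, hs, hnil, hcomm⟩ := exists_semisimple_part x
  refine ⟨s, hs, hcomm e (by rw [← lie_skew, hex, neg_zero]), ?_⟩
  rintro rfl
  rw [map_zero, sub_zero] at hnil
  refine hxx ?_
  rw [killingForm_apply_apply]
  exact (LinearMap.isNilpotent_trace_of_isNilpotent
    ((Commute.refl (LieAlgebra.ad ℂ L x)).isNilpotent_mul_left hnil)).eq_zero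

/-- A Levi subalgebra contains `e` iff its torus commutes with `e`, and is proper iff that torus is
nonzero, the center of `L` being trivial; the line through one semisimple element is enough as a
test torus. -/
lemma isDistinguished_iff [LieAlgebra.IsKilling ℂ L] {e : L} :
    IsDistinguished e ↔ ∀ x : L, IsSemisimpleElement x → ⁅x, e⁆ = 0 → x = 0 := by
  constructor
  · rintro ⟨-, hlb⟩ x hx hxe
    let T : LieSubalgebra ℂ L :=
      { Submodule.span ℂ {x} with
        lie_mem' := by
          intro a b ha hb
          obtain ⟨α, rfl⟩ := Submodule.mem_span_singleton.mp ha
          obtain ⟨β, rfl⟩ := Submodule.mem_span_singleton.mp hb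
          simp }
    have hT {a : L} (ha : a ∈ T) : ∃ α : ℂ, α • x = a := Submodule.mem_span_singleton.mp ha
    let l : LieSubalgebra ℂ L :=
      { carrier := {y | ∀ a ∈ T, ⁅a, y⁆ = 0}
        add_mem' := fun hy hz a ha => by rw [lie_add, hy a ha, hz a ha, add_zero]
        zero_mem' := fun a _ => lie_zero a
        smul_mem' := fun c y hy a ha => by rw [lie_smul, hy a ha, smul_zero]
        lie_mem' := fun {y z} hy hz a ha => by
          rw [leibniz_lie, hy a ha, hz a ha, zero_lie, lie_zero, add_zero] }
    have htop : (⊤ : LieSubalgebra ℂ L) ≤ l := by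
      refine hlb ⟨⟨T, fun a ha => ?_, fun y => Iff.rfl⟩, fun a ha => ?_⟩
      · obtain ⟨α, rfl⟩ := hT ha
        rw [IsSemisimpleElement, map_smul]
        exact Module.End.IsSemisimple.of_mem_adjoin_singleton hx
          (Subalgebra.smul_mem _ (Algebra.self_mem_adjoin_singleton _ _) _)
      · obtain ⟨α, rfl⟩ := hT ha
        rw [smul_lie, hxe, smul_zero]
    refine eq_zero_of_forall_lie_eq_zero fun y => ?_
    exact htop (LieSubalgebra.mem_top y) x (Submodule.mem_span_singleton_self x)
  · refine fun H => ⟨⟨⟨⊥, fun x hx => ?_, fun y => ⟨fun _ x hx => ?_, fun _ => trivial⟩⟩, trivial⟩, ?_⟩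
    · rw [(LieSubalgebra.mem_bot x).mp hx, IsSemisimpleElement, map_zero]
      exact Module.End.isSemisimple_zero
    · rw [(LieSubalgebra.mem_bot x).mp hx, zero_lie]
    · rintro l ⟨⟨T, hT, hl⟩, he⟩ y -
      refine (hl y).mpr fun x hx => ?_
      rw [H x (hT x hx) ((hl e).mp he x hx), zero_lie]

/-- For the characteristic `h` of an `𝔰𝔩₂`-triple, `dim 𝔤₀ = dim 𝔤₂` characterizes distinguished
nilpotent elements. -/
lemma finrank_gradedPart_two_eq_iff_isDistinguished [LieAlgebra.IsKilling ℂ L] {h e f : L}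
    (t : IsSl2Triple h e f) (hss : IsSemisimpleElement h) :
    finrank ℂ (gradedPart h 2) = finrank ℂ (gradedPart h 0) ↔ IsDistinguished e := by
  rw [finrank_gradedPart_two_eq_iff t, isDistinguished_iff]
  refine ⟨fun hc x => eq_zero_of_isSemisimpleElement_of_lie_eq_zero t hss hc,
    fun H y hhy hey => ?_⟩
  by_contra hy0
  obtain ⟨x, hx, hxe, hx0⟩ := exists_isSemisimpleElement_lie_eq_zero t hss hy0 hhy hey
  exact hx0 (H x hx hxe)

end MatrixIntegral

/-! ### Counting vanishing weights at the pole point, and the theorem. -/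

namespace MatrixIntegral

variable {L : Type*} [LieRing L] [LieAlgebra ℂ L] {H : LieSubalgebra ℂ L}

lemma lie_polePoint {h : H} {e f : L} (t : IsSl2Triple (h : L) e f) (ε : ℂ) :
    ⁅e, (polePoint H ε h : L)⁆ = ε • e := by
  change ⁅e, (-(ε / 2)) • (h : L)⁆ = ε • e
  rw [lie_smul, ← lie_skew, t.lie_h_e_smul ℂ, smul_neg, smul_smul, ← neg_smul]
  congr 1
  ring

/-- `e` itself lies in the kernel of `ad u₀ + ε`. -/
lemma denominator_polePoint [FiniteDimensional ℂ L] {h : H} {e f : L}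
    (t : IsSl2Triple (h : L) e f) (ε : ℂ) : denominator H ε (polePoint H ε h) = 0 := by
  by_contra hne
  have hinj := (LinearMap.equivOfDetNeZero _ hne).injective
  refine t.e_ne_zero (hinj (a₁ := e) (a₂ := 0) ?_)
  rw [map_zero]
  change ⁅(polePoint H ε h : L), e⁆ + ε • e = 0
  rw [← lie_skew, lie_polePoint t, neg_add_cancel]

namespace WeightBasis

variable {ι : Type*} [Fintype ι] (B : WeightBasis H ι)

open Classical in
lemma numerator_eq_affineProd [FiniteDimensional ℂ L] [IsLieAbelian H] :
    numerator H = affineProd (Finset.univ.filter fun i => B.weight i ≠ 0) B.weight 0 := by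
  ext u
  simp [B.numerator_eq, affineProd]

lemma denominator_eq_affineProd (ε : ℂ) :
    denominator H ε = affineProd Finset.univ B.weight fun _ => ε := by
  ext u
  exact B.denominator_eq ε u

open Classical in
lemma card_zeroIndices_numerator [IsLieAbelian H] {ε : ℂ} (hε : ε ≠ 0) (h : H) :
    (zeroIndices (Finset.univ.filter fun i => B.weight i ≠ 0) B.weight 0 (polePoint H ε h)).card +
      finrank ℂ H = finrank ℂ (gradedPart (h : L) 0) := by
  rw [B.finrank_gradedPart, ← B.card_weight_eq_zero, ← Finset.card_filter_add_card_filter_not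
    (s := Finset.univ.filter fun i => B.weight i h = ((0 : ℤ) : ℂ)) fun i => B.weight i = 0,
    add_comm, zeroIndices, Finset.filter_filter, Finset.filter_filter, Finset.filter_filter]
  congr 2
  · refine Finset.filter_congr fun i _ => ?_
    refine ⟨fun hi => ⟨by simp [hi], hi⟩, fun hi => hi.2⟩
  · refine Finset.filter_congr fun i _ => ?_
    simp [polePoint, hε, and_comm]

lemma card_zeroIndices_denominator {ε : ℂ} (hε : ε ≠ 0) (h : H) :
    (zeroIndices Finset.univ B.weight (fun _ => ε) (polePoint H ε h)).card =
      finrank ℂ (gradedPart (h : L) 2) := by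
  classical
  rw [B.finrank_gradedPart, zeroIndices]
  congr 1
  refine Finset.filter_congr fun i _ => ?_
  have : B.weight i (polePoint H ε h) + ε = -(ε / 2) * (B.weight i h - 2) := by
    rw [polePoint, map_smul, smul_eq_mul]
    ring
  rw [this, mul_eq_zero, sub_eq_zero]
  simp [hε]

end WeightBasis

end MatrixIntegral

theorem mainTheorem2 {L : Type*} [LieRing L] [LieAlgebra ℂ L] [FiniteDimensional ℂ L]
    [LieAlgebra.IsSemisimple ℂ L] (H : LieSubalgebra ℂ L) [H.IsCartanSubalgebra]
    (ε : ℂ) (hε : ε ≠ 0) (h : H) (e f : L) (triple : IsSl2Triple (h : L) e f) :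
    -- the pole equation at the point given by the triple
    (⁅e, (MatrixIntegral.polePoint H ε h : L)⁆ = ε • e ∧
      MatrixIntegral.denominator H ε (MatrixIntegral.polePoint H ε h) = 0) ∧
    -- the numerator has `dim 𝔤₀ - dim 𝔥` zeros
    (MatrixIntegral.vanishingOrder (MatrixIntegral.numerator H) (MatrixIntegral.polePoint H ε h)
        + (Module.finrank ℂ H : ℕ∞)
      = (Module.finrank ℂ (MatrixIntegral.gradedPart (h : L) 0) : ℕ∞)) ∧
    -- the denominator has `dim 𝔤₂` zeros
    (MatrixIntegral.vanishingOrder (MatrixIntegral.denominator H ε)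
        (MatrixIntegral.polePoint H ε h)
      = (Module.finrank ℂ (MatrixIntegral.gradedPart (h : L) 2) : ℕ∞)) ∧
    -- the pole order is at most the rank, with equality exactly when `e` is distinguished
    (∃ n : ℤ,
      MatrixIntegral.HasPoleOrder (MatrixIntegral.integrand H ε)
        (MatrixIntegral.polePoint H ε h) n ∧
      n = (Module.finrank ℂ (MatrixIntegral.gradedPart (h : L) 2) : ℤ)
        - ((Module.finrank ℂ (MatrixIntegral.gradedPart (h : L) 0) : ℤ)
          - (Module.finrank ℂ H : ℤ)) ∧
      n ≤ (Module.finrank ℂ H : ℤ) ∧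
      (n = (Module.finrank ℂ H : ℤ) ↔ MatrixIntegral.IsDistinguished e)) ∧
    -- a non-vanishing residue, in whatever linear coordinates and over whatever local residue
    -- torus, forces `e` to be distinguished
    (∀ (b : Module.Basis (Fin (Module.finrank ℂ H)) ℂ H)
        (ρ : Fin (Module.finrank ℂ H) → ℝ),
      MatrixIntegral.IsResidueTorus (MatrixIntegral.denominator H ε)
        (MatrixIntegral.polePoint H ε h) b ρ →
      MatrixIntegral.residue (MatrixIntegral.integrand H ε)
        (MatrixIntegral.polePoint H ε h) b ρ ≠ 0 →
      MatrixIntegral.IsDistinguished e) := by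
  classical
  have : LieAlgebra.IsKilling ℂ L := inferInstance
  have hss : MatrixIntegral.IsSemisimpleElement (h : L) :=
    LieAlgebra.IsKilling.isSemisimple_ad_of_mem_isCartanSubalgebra h.2
  obtain ⟨m, ⟨B⟩⟩ := MatrixIntegral.exists_weightBasis H
  have hcN := B.card_zeroIndices_numerator hε h
  have hcD := B.card_zeroIndices_denominator hε h
  have hN (i) (hi : i ∈ MatrixIntegral.zeroIndices (Finset.univ.filter fun i => B.weight i ≠ 0)
      B.weight 0 (MatrixIntegral.polePoint H ε h)) : B.weight i ≠ 0 :=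
    (Finset.mem_filter.mp (Finset.mem_filter.mp hi).1).2
  have hD (i) (hi : i ∈ MatrixIntegral.zeroIndices Finset.univ
      B.weight (fun _ => ε) (MatrixIntegral.polePoint H ε h)) : B.weight i ≠ 0 := by
    intro h0
    have := (Finset.mem_filter.mp hi).2
    rw [h0, LinearMap.zero_apply, zero_add] at this
    exact hε this
  have hle := MatrixIntegral.finrank_gradedPart_two_le triple
  have hdist := MatrixIntegral.finrank_gradedPart_two_eq_iff_isDistinguished triple hss
  have hF : MatrixIntegral.integrand H ε = fun u =>
      MatrixIntegral.affineProd (Finset.univ.filter fun i => B.weight i ≠ 0) B.weight 0 u /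
        MatrixIntegral.affineProd Finset.univ B.weight (fun _ => ε) u := by
    rw [← B.numerator_eq_affineProd, ← B.denominator_eq_affineProd]
    rfl
  refine ⟨⟨MatrixIntegral.lie_polePoint triple ε, MatrixIntegral.denominator_polePoint triple ε⟩,
    ?_, ?_, ⟨_, ?_, rfl, ?_, ?_⟩, fun b ρ hρ hres => ?_⟩
  · rw [B.numerator_eq_affineProd, MatrixIntegral.vanishingOrder_affineProd hN, ← hcN]
    push_cast
    rfl
  · rw [B.denominator_eq_affineProd, MatrixIntegral.vanishingOrder_affineProd hD, hcD]
  · rw [hF]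
    convert! MatrixIntegral.hasPoleOrder_affineProd_div hN hD using 1
    omega
  · omega
  · rw [← hdist]
    omega
  · rw [← hdist]
    -- If `dim 𝔤₂ < dim 𝔤₀`, the pole order is below the rank and the residue would vanish.
    refine hle.antisymm (not_lt.mp fun hlt => hres ?_)
    rw [B.denominator_eq_affineProd] at hρ
    rw [hF]
    exact MatrixIntegral.residue_affineProd_div_eq_zero b hρ (by rw [hcD, hcN]; exact hlt)
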